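/- **Proposition (fractional Caffarelli–Kohn–Nirenberg inequality).** Let $n\ge 2$ be an integer, let $\gamma\in(0,1)$, and let $\alpha,\beta\in\mathbb R$ satisfy $$\alpha\le\beta\le\alpha+\gamma,\qquad -2\gamma<\alpha<\frac{n-2\gamma}{2}.$$ Set $$p=\frac{2n}{n-2\gamma+2(\beta-\alpha)}.$$ Then there exists a constant $\Lambda>0$, depending only on $n,\gamma,\alpha,\beta$, such that for every real-valued $u\in C_c^\infty(\mathbb R^n)$ the integrals below are finite and $$\Lambda\left(\int_{\mathbb R^n}\frac{|u(x)|^p}{|x|^{\beta p}}\,dx\right)^{2/p}\le\int_{\mathbb R^n}\int_{\mathbb R^n}\frac{(u(x)-u(y))^2}{|x-y|^{n+2\gamma}|x|^\alpha|y|^\alpha}\,dy\,dx .$$ -/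

import Mathlib

open MeasureTheory
open scoped ENNReal ContDiff

/-- The exponent `p = 2n / (n - 2γ + 2(β - α))`. -/
noncomputable def cknExponent (n : ℕ) (γ α β : ℝ) : ℝ :=
  2 * n / (n - 2 * γ + 2 * (β - α))

/-- The weighted integral `∫_{ℝⁿ} |u(x)|^p / |x|^(β p) dx`, with values in `[0, ∞]`. -/
noncomputable def cknWeightedIntegral {n : ℕ} (β p : ℝ)
    (u : EuclideanSpace ℝ (Fin n) → ℝ) : ℝ≥0∞ :=
  ∫⁻ x, ENNReal.ofReal (|u x| ^ p / ‖x‖ ^ (β * p))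

/-- The weighted fractional energy
`∫_{ℝⁿ} ∫_{ℝⁿ} (u(x) - u(y))² / (|x - y|^(n + 2γ) |x|^α |y|^α) dy dx`, with values in `[0, ∞]`.
The values of the integrand on the null sets `x = y`, `x = 0` and `y = 0` do not matter. -/
noncomputable def cknEnergy {n : ℕ} (γ α : ℝ)
    (u : EuclideanSpace ℝ (Fin n) → ℝ) : ℝ≥0∞ :=
  ∫⁻ x, ∫⁻ y, ENNReal.ofReal
    ((u x - u y) ^ 2 / (‖x - y‖ ^ ((n : ℝ) + 2 * γ) * ‖x‖ ^ α * ‖y‖ ^ α))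

/-! Write T for the weighted integral, E for the energy, H for the weighted integral with β = α + γ
and p = 2, and s = 1 - 2/p, so that n s = 2(γ - (β - α)).

The endpoint H ≤ C E (`hardy_weighted`) comes from comparing u(x) with u(y) for y in an annulus of
radius about l‖x‖. Averaging u(y)² there costs l^(2(α+γ)) against a gain of l^n. Since 2(α + γ) < n,
a large l lets this term be absorbed.

The other exponents follow from a Hedberg-type pointwise bound (`pointwise_bound`): |u(x)|^p
‖x‖^(-βp) ≤ C T^s (D(x) + u(x)² ‖x‖^(-2(α+γ))), with D(x) the inner integral of the energy. On a
ball around x of radius r ≤ ‖x‖/2, each y has either u(y) large or u(x) - u(y) large, which bounds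
the volume of the ball by terms in D(x) and T; then r is optimised.

Integrating gives T ≤ C T^s (E + H) ≤ C' T^s E, and dividing by T^s leaves T^(2/p). Both absorption
and division need finite quantities, supplied by continuity, compact support and integrability of
the weights at 0. -/

/-! ### Power weights: comparability and integrability -/

theorem rpow_le_mul_rpow_of_comparable {t ρ K a : ℝ} (ht : 0 < t) (hρ : 0 < ρ) (hK : 1 ≤ K)
    (h₁ : t ≤ K * ρ) (h₂ : ρ ≤ K * t) : t ^ a ≤ K ^ |a| * ρ ^ a := by
  have hK0 : 0 < K := by linarith
  rcases le_total 0 a with ha | ha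
  · rw [abs_of_nonneg ha, ← Real.mul_rpow hK0.le hρ.le]
    exact Real.rpow_le_rpow ht.le h₁ ha
  · have h : ρ / K ≤ t := by rw [div_le_iff₀ hK0]; linarith
    calc t ^ a ≤ (ρ / K) ^ a := Real.rpow_le_rpow_of_nonpos (by positivity) h ha
      _ = K ^ |a| * ρ ^ a := by
        rw [Real.div_rpow hρ.le hK0.le, abs_of_nonpos ha, Real.rpow_neg hK0.le]
        field_simp

/-- In polar coordinates the integrand becomes t^(n-1-a), integrable at 0 exactly when a < n. -/
theorem lintegral_ball_inv_norm_rpow_lt_top {n : ℕ} (hn : 1 ≤ n) {a : ℝ} (ha : a < n) (R : ℝ) :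
    ∫⁻ x in Metric.ball (0 : EuclideanSpace ℝ (Fin n)) R, ENNReal.ofReal ((‖x‖ ^ a)⁻¹) < ⊤ := by
  rcases le_or_gt R 0 with hR | hR
  · simp [Metric.ball_eq_empty.2 hR]
  have : Nonempty (Fin n) := ⟨⟨0, hn⟩⟩
  have h : IntegrableOn (fun x : EuclideanSpace ℝ (Fin n) => (fun t : ℝ => (t ^ a)⁻¹) ‖x‖)
      (Metric.ball 0 R) := by
    refine (integrableOn_fun_norm_addHaar volume (f := fun t : ℝ => (t ^ a)⁻¹)).2 ?_
    have h2 : IntegrableOn (fun t : ℝ => t ^ ((n : ℝ) - 1 - a)) (Set.Ioo 0 R) := by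
      rw [intervalIntegral.integrableOn_Ioo_rpow_iff hR]; linarith
    refine h2.congr_fun (fun t ht => ?_) measurableSet_Ioo
    have ht0 : 0 < t := ht.1
    simp only [finrank_euclideanSpace, Fintype.card_fin, smul_eq_mul]
    rw [Real.rpow_sub ht0, ← Nat.cast_one, ← Nat.cast_sub hn, Real.rpow_natCast]
    rfl
  exact h.lintegral_lt_top

theorem lintegral_compl_ball_inv_norm_rpow_lt_top {n : ℕ} (hn : 1 ≤ n) {a : ℝ} (ha : n < a)
    {R : ℝ} (hR : 0 < R) :
    ∫⁻ x in (Metric.ball (0 : EuclideanSpace ℝ (Fin n)) R)ᶜ, ENNReal.ofReal ((‖x‖ ^ a)⁻¹) < ⊤ := by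
  have : Nonempty (Fin n) := ⟨⟨0, hn⟩⟩
  -- The cutoff makes the integrand a radial function on the whole space, so that polar coordinates
  -- apply.
  have h : Integrable (fun x : EuclideanSpace ℝ (Fin n) =>
      (Set.indicator (Set.Ici R) fun t : ℝ => (t ^ a)⁻¹) ‖x‖) := by
    rw [integrable_fun_norm_addHaar]
    have h2 : IntegrableOn (fun t : ℝ => t ^ ((n : ℝ) - 1 - a)) (Set.Ici R) := by
      rw [integrableOn_Ici_iff_integrableOn_Ioi]
      exact integrableOn_Ioi_rpow_of_lt (by linarith) hR
    have h3 := (integrable_indicator_iff measurableSet_Ici).2 h2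
    refine h3.integrableOn.congr_fun (fun t ht => ?_) measurableSet_Ioi
    have ht0 : 0 < t := ht
    simp only [finrank_euclideanSpace, Fintype.card_fin, smul_eq_mul, Set.indicator]
    split_ifs
    · rw [Real.rpow_sub ht0, ← Nat.cast_one, ← Nat.cast_sub hn, Real.rpow_natCast]
      rfl
    · simp
  have h4 := h.lintegral_lt_top
  rw [← lintegral_indicator Metric.isOpen_ball.measurableSet.compl]
  refine lt_of_le_of_lt (lintegral_mono fun x => ?_) h4
  simp only [Set.indicator]
  split_ifs <;> simp_all

theorem lintegral_div_norm_rpow_lt_top {n : ℕ} (hn : 1 ≤ n) {a : ℝ} (ha : a < n)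
    {g : EuclideanSpace ℝ (Fin n) → ℝ} (hg : Continuous g) (hc : HasCompactSupport g) :
    ∫⁻ x, ENNReal.ofReal (g x / ‖x‖ ^ a) < ⊤ := by
  obtain ⟨M, hM⟩ := hg.bounded_above_of_compact_support hc
  obtain ⟨R, hR⟩ := hc.isCompact.isBounded.subset_ball 0
  have hM0 : 0 ≤ M := (norm_nonneg _).trans (hM 0)
  calc ∫⁻ x, ENNReal.ofReal (g x / ‖x‖ ^ a)
      ≤ ∫⁻ x, (Metric.ball (0 : EuclideanSpace ℝ (Fin n)) R).indicator
          (fun x => ENNReal.ofReal M * ENNReal.ofReal ((‖x‖ ^ a)⁻¹)) x := by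
        refine lintegral_mono fun x => ?_
        by_cases hx : x ∈ Metric.ball (0 : EuclideanSpace ℝ (Fin n)) R
        · rw [Set.indicator_of_mem hx, ← ENNReal.ofReal_mul hM0]
          refine ENNReal.ofReal_le_ofReal ?_
          rw [div_eq_mul_inv]
          exact mul_le_mul_of_nonneg_right ((le_abs_self _).trans (hM x)) (by positivity)
        · have : g x = 0 := by
            by_contra h
            exact hx (hR (subset_tsupport _ h))
          simp [this]
    _ = ENNReal.ofReal M * ∫⁻ x in Metric.ball (0 : EuclideanSpace ℝ (Fin n)) R,
          ENNReal.ofReal ((‖x‖ ^ a)⁻¹) := by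
        rw [lintegral_indicator Metric.isOpen_ball.measurableSet,
          lintegral_const_mul' _ _ ENNReal.ofReal_ne_top]
    _ < ⊤ := ENNReal.mul_lt_top ENNReal.ofReal_lt_top
        (lintegral_ball_inv_norm_rpow_lt_top hn ha R)

theorem cknWeightedIntegral_lt_top {n : ℕ} (hn : 1 ≤ n) {β p : ℝ} (hp : 0 < p) (h : β * p < n)
    {u : EuclideanSpace ℝ (Fin n) → ℝ} (hu : Continuous u) (hc : HasCompactSupport u) :
    cknWeightedIntegral β p u < ⊤ := by
  refine lintegral_div_norm_rpow_lt_top hn h (g := fun x => |u x| ^ p)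
    (hu.abs.rpow_const fun _ => Or.inr hp.le) ?_
  refine hc.comp_left (g := fun t : ℝ => |t| ^ p) ?_
  simp [Real.zero_rpow hp.ne']

/-! ### Fractional Hardy inequality -/

theorem exists_dilation_rpow_le (M : ℝ) {s d : ℝ} (h : s < d) :
    ∃ l : ℝ, 1 ≤ l ∧ M * l ^ s ≤ l ^ d := by
  have h1 := (tendsto_rpow_atTop (sub_pos.2 h)).eventually_ge_atTop M
  obtain ⟨l, hl, hl1⟩ := (h1.and (Filter.eventually_ge_atTop 1)).exists
  refine ⟨l, hl1, ?_⟩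
  have hl0 : 0 < l := by linarith
  calc M * l ^ s ≤ l ^ (d - s) * l ^ s := by gcongr
    _ = l ^ d := by rw [← Real.rpow_add hl0]; congr 1; ring

/-- Pairs `(x, y)` with `y` in the annulus `l ‖x‖ ≤ ‖y‖ < 2 l ‖x‖`. -/
def dilatedAnnulus (n : ℕ) (l : ℝ) :
    Set (EuclideanSpace ℝ (Fin n) × EuclideanSpace ℝ (Fin n)) :=
  {q | l * ‖q.1‖ ≤ ‖q.2‖ ∧ ‖q.2‖ < 2 * l * ‖q.1‖}

theorem measurableSet_dilatedAnnulus (n : ℕ) (l : ℝ) : MeasurableSet (dilatedAnnulus n l) := by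
  have h1 : MeasurableSet {q : EuclideanSpace ℝ (Fin n) × EuclideanSpace ℝ (Fin n) |
      l * ‖q.1‖ ≤ ‖q.2‖} := measurableSet_le (by fun_prop) (by fun_prop)
  have h2 : MeasurableSet {q : EuclideanSpace ℝ (Fin n) × EuclideanSpace ℝ (Fin n) |
      ‖q.2‖ < 2 * l * ‖q.1‖} := measurableSet_lt (by fun_prop) (by fun_prop)
  exact h1.inter h2

theorem norm_pos_of_mem_dilatedAnnulus {n : ℕ} {l : ℝ} (hl : 1 ≤ l)
    {x y : EuclideanSpace ℝ (Fin n)} (h : (x, y) ∈ dilatedAnnulus n l) : 0 < ‖x‖ ∧ 0 < ‖y‖ := by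
  obtain ⟨h1, h2⟩ := h
  simp only at h1 h2
  have hx : 0 < ‖x‖ := by
    refine lt_of_le_of_ne (norm_nonneg _) fun h0 => ?_
    rw [← h0] at h1 h2
    linarith
  exact ⟨hx, (mul_pos (one_pos.trans_le hl) hx).trans_le h1⟩

theorem le_volume_annulus {n : ℕ} (hn : 1 ≤ n) {R : ℝ} (hR : 0 < R) :
    ENNReal.ofReal (R ^ n) * volume (Metric.ball (0 : EuclideanSpace ℝ (Fin n)) 1) ≤
      volume {y : EuclideanSpace ℝ (Fin n) | R ≤ ‖y‖ ∧ ‖y‖ < 2 * R} := by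
  have : Nonempty (Fin n) := ⟨⟨0, hn⟩⟩
  have hset : {y : EuclideanSpace ℝ (Fin n) | R ≤ ‖y‖ ∧ ‖y‖ < 2 * R} =
      Metric.ball 0 (2 * R) \ Metric.ball 0 R := by
    ext y
    simp [and_comm]
  rw [hset]
  refine le_trans ?_ le_measure_sdiff
  rw [Measure.addHaar_ball _ _ hR.le, Measure.addHaar_ball _ _ (by positivity : 0 ≤ 2 * R)]
  simp only [finrank_euclideanSpace, Fintype.card_fin]
  refine ENNReal.le_sub_of_add_le_right
    (ENNReal.mul_ne_top ENNReal.ofReal_ne_top measure_ball_lt_top.ne) ?_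
  rw [← add_mul, ← ENNReal.ofReal_add (by positivity) (by positivity)]
  gcongr
  rw [mul_pow]
  have h2 : (2 : ℝ) ≤ 2 ^ n := by
    calc (2 : ℝ) = 2 ^ 1 := by norm_num
      _ ≤ 2 ^ n := pow_le_pow_right₀ (by norm_num) hn
  nlinarith [pow_pos hR n]

section Hardy

variable {n : ℕ} {l s γ α : ℝ} {u : EuclideanSpace ℝ (Fin n) → ℝ}

/-- The bound u(x)² ≤ 2u(y)² + 2(u(x) - u(y))² is integrated over the annulus. Its volume is at
least a constant times (l‖x‖)^n, which turns the weight ‖x‖^(-(s+n)) into l^n ‖x‖^(-s). -/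
theorem hardy_split (hn : 1 ≤ n) (hl : 1 ≤ l) {x : EuclideanSpace ℝ (Fin n)} (hx : x ≠ 0)
    (hu : Measurable u) :
    ENNReal.ofReal (l ^ n) * volume (Metric.ball (0 : EuclideanSpace ℝ (Fin n)) 1) *
        ENNReal.ofReal (|u x| ^ (2 : ℝ) / ‖x‖ ^ s) ≤
      (∫⁻ y, (dilatedAnnulus n l).indicator
        (fun q => ENNReal.ofReal (2 * u q.2 ^ 2 * ‖q.1‖ ^ (-(s + n)))) (x, y)) +
      ∫⁻ y, (dilatedAnnulus n l).indicator
        (fun q => ENNReal.ofReal (2 * (u q.1 - u q.2) ^ 2 * ‖q.1‖ ^ (-(s + n)))) (x, y) := by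
  have hx0 : 0 < ‖x‖ := norm_pos_iff.2 hx
  have hl0 : 0 < l := by linarith
  set A : Set (EuclideanSpace ℝ (Fin n)) := {y | l * ‖x‖ ≤ ‖y‖ ∧ ‖y‖ < 2 * (l * ‖x‖)} with hA
  have hmem : ∀ y, y ∈ A ↔ (x, y) ∈ dilatedAnnulus n l := by
    intro y
    simp [hA, dilatedAnnulus, mul_assoc]
  have hmA : MeasurableSet A := by
    have : A = Prod.mk x ⁻¹' dilatedAnnulus n l := Set.ext hmem
    rw [this]
    exact measurable_prodMk_left (measurableSet_dilatedAnnulus n l)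
  have hm1 : Measurable fun y => (dilatedAnnulus n l).indicator
      (fun q => ENNReal.ofReal (2 * u q.2 ^ 2 * ‖q.1‖ ^ (-(s + n)))) (x, y) := by
    refine Measurable.comp (Measurable.indicator ?_ (measurableSet_dilatedAnnulus n l))
      measurable_prodMk_left
    fun_prop
  rw [← lintegral_add_left hm1]
  calc ENNReal.ofReal (l ^ n) * volume (Metric.ball (0 : EuclideanSpace ℝ (Fin n)) 1) *
        ENNReal.ofReal (|u x| ^ (2 : ℝ) / ‖x‖ ^ s)
      = ENNReal.ofReal (u x ^ 2 * ‖x‖ ^ (-(s + n))) * (ENNReal.ofReal ((l * ‖x‖) ^ n) *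
          volume (Metric.ball (0 : EuclideanSpace ℝ (Fin n)) 1)) := by
        rw [mul_right_comm, ← ENNReal.ofReal_mul (by positivity), ← mul_assoc,
          ← ENNReal.ofReal_mul (by positivity)]
        congr 2
        rw [Real.rpow_two, sq_abs, Real.rpow_neg hx0.le, Real.rpow_add hx0, Real.rpow_natCast,
          mul_pow]
        field_simp
    _ ≤ ENNReal.ofReal (u x ^ 2 * ‖x‖ ^ (-(s + n))) * volume A := by
        gcongr
        exact le_volume_annulus hn (by positivity)
    _ = ∫⁻ y, A.indicator (fun _ => ENNReal.ofReal (u x ^ 2 * ‖x‖ ^ (-(s + n)))) y := by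
        rw [lintegral_indicator_const hmA]
    _ ≤ _ := by
        refine lintegral_mono fun y => ?_
        by_cases hy : y ∈ A
        · rw [Set.indicator_of_mem hy, Set.indicator_of_mem ((hmem y).1 hy),
            Set.indicator_of_mem ((hmem y).1 hy),
            ← ENNReal.ofReal_add (by positivity) (by positivity), ← add_mul]
          refine ENNReal.ofReal_le_ofReal (mul_le_mul_of_nonneg_right ?_ (by positivity))
          simp only
          -- The difference of the two sides is exactly (u x - 2 u y)².
          nlinarith [sq_nonneg (u x - 2 * u y)]
        · rw [Set.indicator_of_notMem hy]
          exact bot_le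

/-- For fixed y, the points x lie in the ball of radius ρ = ‖y‖/l and have norm comparable to ρ. The
integral is therefore of order ρ^(-s) = l^s ‖y‖^(-s): only l^s, to be set against the l^n of
`hardy_split`. -/
theorem hardy_average_le (hn : 1 ≤ n) (hl : 1 ≤ l) (y : EuclideanSpace ℝ (Fin n)) :
    ∫⁻ x, (dilatedAnnulus n l).indicator
        (fun q => ENNReal.ofReal (2 * u q.2 ^ 2 * ‖q.1‖ ^ (-(s + n)))) (x, y) ≤
      ENNReal.ofReal (2 * 2 ^ |-(s + n)| * l ^ s) *
        volume (Metric.ball (0 : EuclideanSpace ℝ (Fin n)) 1) *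
        ENNReal.ofReal (|u y| ^ (2 : ℝ) / ‖y‖ ^ s) := by
  have : Nonempty (Fin n) := ⟨⟨0, hn⟩⟩
  have hl0 : 0 < l := by linarith
  rcases eq_or_ne y 0 with hy | hy
  · have h0 : ∀ x, (dilatedAnnulus n l).indicator
        (fun q => ENNReal.ofReal (2 * u q.2 ^ 2 * ‖q.1‖ ^ (-(s + n)))) (x, y) = 0 := by
      intro x
      refine Set.indicator_of_notMem (fun h => ?_) _
      have := (norm_pos_of_mem_dilatedAnnulus hl h).2
      simp [hy] at this
    rw [lintegral_congr h0, lintegral_zero]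
    exact bot_le
  have hy0 : 0 < ‖y‖ := norm_pos_iff.2 hy
  set ρ := ‖y‖ / l with hρ
  have hρ0 : 0 < ρ := by positivity
  have hyρ : ‖y‖ = l * ρ := by rw [hρ]; field_simp
  calc _ ≤ ∫⁻ x, (Metric.closedBall (0 : EuclideanSpace ℝ (Fin n)) ρ).indicator
        (fun _ => ENNReal.ofReal (2 * u y ^ 2 * (2 ^ |-(s + n)| * ρ ^ (-(s + n))))) x := by
        refine lintegral_mono fun x => ?_
        by_cases h : (x, y) ∈ dilatedAnnulus n l
        · have hx0 := (norm_pos_of_mem_dilatedAnnulus hl h).1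
          have h1 : l * ‖x‖ ≤ ‖y‖ := h.1
          have h2 : ‖y‖ < 2 * l * ‖x‖ := h.2
          have h1' : ‖x‖ ≤ ρ := by rw [hρ, le_div_iff₀ hl0]; linarith
          have h2' : ρ ≤ 2 * ‖x‖ := by rw [hρ, div_le_iff₀ hl0]; linarith
          rw [Set.indicator_of_mem h, Set.indicator_of_mem (by simpa using h1')]
          refine ENNReal.ofReal_le_ofReal (mul_le_mul_of_nonneg_left ?_ (by positivity))
          exact rpow_le_mul_rpow_of_comparable hx0 hρ0 (by norm_num) (by linarith) h2'
        · rw [Set.indicator_of_notMem h]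
          exact bot_le
    _ = ENNReal.ofReal (2 * u y ^ 2 * (2 ^ |-(s + n)| * ρ ^ (-(s + n)))) *
          (ENNReal.ofReal (ρ ^ n) * volume (Metric.ball (0 : EuclideanSpace ℝ (Fin n)) 1)) := by
        rw [lintegral_indicator_const Metric.isClosed_closedBall.measurableSet,
          Measure.addHaar_closedBall _ _ hρ0.le]
        simp
    _ = _ := by
        rw [mul_right_comm (ENNReal.ofReal _), ← ENNReal.ofReal_mul (by positivity), ← mul_assoc,
          ← ENNReal.ofReal_mul (by positivity)]
        congr 2
        rw [hyρ, Real.mul_rpow hl0.le hρ0.le, Real.rpow_two, sq_abs, Real.rpow_neg hρ0.le,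
          Real.rpow_add hρ0, Real.rpow_natCast]
        have := Real.rpow_pos_of_pos hl0 s
        have := Real.rpow_pos_of_pos hρ0 s
        field_simp

/-- On the annulus ‖x - y‖ ≤ 3l‖x‖ and ‖y‖ is comparable to ‖x‖, so the energy kernel dominates a
multiple of ‖x‖^(-(n+2γ+2α)). -/
theorem hardy_difference_le (hl : 1 ≤ l) (hγ : 0 < γ) (x y : EuclideanSpace ℝ (Fin n)) :
    (dilatedAnnulus n l).indicator (fun q =>
        ENNReal.ofReal (2 * (u q.1 - u q.2) ^ 2 * ‖q.1‖ ^ (-((α + γ) * 2 + n)))) (x, y) ≤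
      ENNReal.ofReal (2 * (3 * l) ^ (n + 2 * γ) * (2 * l) ^ |α|) * ENNReal.ofReal
        ((u x - u y) ^ 2 / (‖x - y‖ ^ ((n : ℝ) + 2 * γ) * ‖x‖ ^ α * ‖y‖ ^ α)) := by
  by_cases h : (x, y) ∈ dilatedAnnulus n l
  swap
  · rw [Set.indicator_of_notMem h]
    exact bot_le
  rw [Set.indicator_of_mem h]
  rcases eq_or_ne x y with hxy | hxy
  · simp [hxy]
  obtain ⟨hx0, hy0⟩ := norm_pos_of_mem_dilatedAnnulus hl h
  have h1 : l * ‖x‖ ≤ ‖y‖ := h.1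
  have h2 : ‖y‖ < 2 * l * ‖x‖ := h.2
  have hd : 0 < ‖x - y‖ := norm_pos_iff.2 (sub_ne_zero.2 hxy)
  have hl0 : 0 < l := by linarith
  rw [← ENNReal.ofReal_mul (by positivity)]
  refine ENNReal.ofReal_le_ofReal ?_
  have hD : ‖x - y‖ ^ ((n : ℝ) + 2 * γ) ≤ (3 * l) ^ (n + 2 * γ) * ‖x‖ ^ (n + 2 * γ) := by
    rw [← Real.mul_rpow (by positivity) hx0.le]
    refine Real.rpow_le_rpow hd.le ?_ (by positivity)
    have := norm_sub_le x y
    nlinarith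
  have hY : ‖y‖ ^ α ≤ (2 * l) ^ |α| * ‖x‖ ^ α :=
    rpow_le_mul_rpow_of_comparable hy0 hx0 (by linarith) h2.le (by nlinarith)
  have hE : ‖x‖ ^ (-((α + γ) * 2 + n)) = (‖x‖ ^ (n + 2 * γ) * ‖x‖ ^ α * ‖x‖ ^ α)⁻¹ := by
    rw [← Real.rpow_add hx0, ← Real.rpow_add hx0, ← Real.rpow_neg hx0.le]
    congr 1; ring
  have hdp := Real.rpow_pos_of_pos hd ((n : ℝ) + 2 * γ)
  have hxa := Real.rpow_pos_of_pos hx0 α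
  have hya := Real.rpow_pos_of_pos hy0 α
  have hxn := Real.rpow_pos_of_pos hx0 (n + 2 * γ)
  simp only
  rw [hE, mul_div_assoc', ← div_eq_mul_inv, div_le_div_iff₀ (by positivity) (by positivity)]
  calc 2 * (u x - u y) ^ 2 * (‖x - y‖ ^ ((n : ℝ) + 2 * γ) * ‖x‖ ^ α * ‖y‖ ^ α)
      ≤ 2 * (u x - u y) ^ 2 * (((3 * l) ^ (n + 2 * γ) * ‖x‖ ^ (n + 2 * γ)) * ‖x‖ ^ α *
          ((2 * l) ^ |α| * ‖x‖ ^ α)) := by gcongr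
    _ = _ := by ring

/-- Fractional Hardy inequality with power weights, for functions whose weighted `L²` norm is
finite. -/
theorem hardy_weighted (hn : 1 ≤ n) (hγ : 0 < γ) (hα : α < ((n : ℝ) - 2 * γ) / 2) :
    ∃ C : ℝ≥0∞, C ≠ ⊤ ∧ ∀ u : EuclideanSpace ℝ (Fin n) → ℝ, Measurable u →
      cknWeightedIntegral (α + γ) 2 u ≠ ⊤ →
      cknWeightedIntegral (α + γ) 2 u ≤ C * cknEnergy γ α u := by
  have : Nonempty (Fin n) := ⟨⟨0, hn⟩⟩
  set s := (α + γ) * 2 with hs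
  -- The factor 4 makes the averaged term, with constant 2 * 2^|-(s+n)| * l^s, at most half of l^n.
  obtain ⟨l, hl, hl2⟩ := exists_dilation_rpow_le (4 * 2 ^ |-(s + n)|)
    (show s < n by rw [hs]; linarith)
  rw [Real.rpow_natCast] at hl2
  have hl0 : 0 < l := by linarith
  set v := volume (Metric.ball (0 : EuclideanSpace ℝ (Fin n)) 1) with hv
  have hv0 : v ≠ 0 := (Metric.measure_ball_pos _ _ one_pos).ne'
  have hvt : v ≠ ⊤ := measure_ball_lt_top.ne
  set K := ENNReal.ofReal (2 * (3 * l) ^ (n + 2 * γ) * (2 * l) ^ |α|) with hK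
  set b := ENNReal.ofReal (l ^ n / 2) * v with hb
  have hb0 : b ≠ 0 := mul_ne_zero (by simpa using pow_pos hl0 n) hv0
  have hbt : b ≠ ⊤ := ENNReal.mul_ne_top ENNReal.ofReal_ne_top hvt
  refine ⟨b⁻¹ * K, ENNReal.mul_ne_top (ENNReal.inv_ne_top.2 hb0) ENNReal.ofReal_ne_top,
    fun u hu hH => ?_⟩
  set H := cknWeightedIntegral (α + γ) 2 u with hHdef
  have hm1 : Measurable ((dilatedAnnulus n l).indicator
      (fun q => ENNReal.ofReal (2 * u q.2 ^ 2 * ‖q.1‖ ^ (-(s + n))))) := by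
    refine Measurable.indicator ?_ (measurableSet_dilatedAnnulus n l)
    fun_prop
  have key : b * H + b * H ≤ b * H + K * cknEnergy γ α u := by
    calc b * H + b * H = ∫⁻ x, ENNReal.ofReal (l ^ n) * v *
          ENNReal.ofReal (|u x| ^ (2 : ℝ) / ‖x‖ ^ s) := by
          rw [lintegral_const_mul' _ _ (ENNReal.mul_ne_top ENNReal.ofReal_ne_top hvt), ← add_mul,
            hb, ← add_mul, ← ENNReal.ofReal_add (by positivity) (by positivity), add_halves]
          rfl
      _ ≤ ∫⁻ x, ((∫⁻ y, (dilatedAnnulus n l).indicator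
            (fun q => ENNReal.ofReal (2 * u q.2 ^ 2 * ‖q.1‖ ^ (-(s + n)))) (x, y)) +
          ∫⁻ y, (dilatedAnnulus n l).indicator
            (fun q => ENNReal.ofReal (2 * (u q.1 - u q.2) ^ 2 * ‖q.1‖ ^ (-(s + n)))) (x, y)) := by
          refine lintegral_mono_ae ?_
          filter_upwards [Measure.ae_ne volume (0 : EuclideanSpace ℝ (Fin n))] with x hx
          exact hardy_split hn hl hx hu
      _ = (∫⁻ y, ∫⁻ x, (dilatedAnnulus n l).indicator
            (fun q => ENNReal.ofReal (2 * u q.2 ^ 2 * ‖q.1‖ ^ (-(s + n)))) (x, y)) +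
          ∫⁻ x, ∫⁻ y, (dilatedAnnulus n l).indicator
            (fun q => ENNReal.ofReal (2 * (u q.1 - u q.2) ^ 2 * ‖q.1‖ ^ (-(s + n)))) (x, y) := by
          rw [lintegral_add_left hm1.lintegral_prod_right', lintegral_lintegral_swap]
          exact hm1.aemeasurable
      _ ≤ (∫⁻ y, b * ENNReal.ofReal (|u y| ^ (2 : ℝ) / ‖y‖ ^ s)) +
          ∫⁻ x, ∫⁻ y, K * ENNReal.ofReal
            ((u x - u y) ^ 2 / (‖x - y‖ ^ ((n : ℝ) + 2 * γ) * ‖x‖ ^ α * ‖y‖ ^ α)) := by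
          gcongr with y x y
          · refine (hardy_average_le hn hl y).trans ?_
            rw [hb]
            gcongr
            linarith
          · exact hardy_difference_le hl hγ x y
      _ = b * H + K * cknEnergy γ α u := by
          rw [lintegral_const_mul' _ _ hbt]
          simp_rw [lintegral_const_mul' K _ ENNReal.ofReal_ne_top]
          rfl
  -- Absorption: cancelling b * H requires H to be finite.
  have key2 : b * H ≤ K * cknEnergy γ α u :=
    (ENNReal.add_le_add_iff_left (ENNReal.mul_ne_top hbt hH)).1 key
  calc H = b⁻¹ * (b * H) := by rw [← mul_assoc, ENNReal.inv_mul_cancel hb0 hbt, one_mul]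
    _ ≤ b⁻¹ * (K * cknEnergy γ α u) := by gcongr
    _ = _ := by rw [mul_assoc]

end Hardy

/-! ### Hedberg-type pointwise bound -/

/-- Optimisation over the radius in a Hedberg-type argument. -/
theorem rpow_div_le_of_forall_radius {N γ α β p s c A B t a X D : ℝ} (hN : 0 < N) (hp : 0 < p)
    (hs : s = 1 - 2 / p) (hs0 : 0 ≤ s) (hNs : N * s = 2 * (γ - (β - α))) (hαβ : α ≤ β)
    (hc : 0 < c) (hA : 0 < A) (hB : 0 < B) (ht : 0 < t) (ha : 0 < a) (hX : 0 < X) (hD : 0 ≤ D)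
    (h : ∀ r, 0 < r → r ≤ X / 2 → c * r ^ N ≤
      A / a ^ 2 * r ^ (N + 2 * γ) * X ^ (2 * α) * D + B / a ^ p * X ^ (β * p) * t) :
    a ^ p / X ^ (β * p) ≤ (2 * B / c) ^ s * (2 * A / c + 2 ^ (N * s)) * t ^ s *
      (D + a ^ (2 : ℝ) / X ^ ((α + γ) * 2)) := by
  set Φ := a ^ p / X ^ (β * p) with hΦ
  have hap : 0 < a ^ p := Real.rpow_pos_of_pos ha p
  have hXp : 0 < X ^ (β * p) := Real.rpow_pos_of_pos hX _
  have hΦ0 : 0 < Φ := div_pos hap hXp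
  -- Q is the value of r^N at which the t-term of `h` equals half of c * r^N.
  set Q := 2 * B / c * t / Φ with hQ
  have hQ0 : 0 < Q := by positivity
  have hΦs : 0 < Φ ^ s := Real.rpow_pos_of_pos hΦ0 s
  have hQs : Φ ^ s * Q ^ s = (2 * B / c) ^ s * t ^ s := by
    rw [← Real.mul_rpow hΦ0.le hQ0.le, ← Real.mul_rpow (by positivity) ht.le]
    congr 1
    rw [hQ]; field_simp
  have hX2 : 0 < X ^ (2 * β) := Real.rpow_pos_of_pos hX _
  -- Since s + 2/p = 1, Φ splits as Φ^s Φ^(2/p); the factor Φ^s pairs with Q^s to give t^s.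
  have hΦ2 : Φ = Φ ^ s * (a ^ 2 / X ^ (2 * β)) := by
    have h1 : Φ ^ (2 / p) = a ^ 2 / X ^ (2 * β) := by
      rw [hΦ, Real.div_rpow hap.le hXp.le, ← Real.rpow_mul ha.le, ← Real.rpow_mul hX.le,
        mul_div_cancel₀ _ hp.ne', Real.rpow_two]
      congr 2
      field_simp
    rw [← h1, ← Real.rpow_add hΦ0, hs, sub_add_cancel, Real.rpow_one]
  have hts : 0 < t ^ s := Real.rpow_pos_of_pos ht s
  have hBs : 0 < (2 * B / c) ^ s := Real.rpow_pos_of_pos (by positivity) s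
  have h2s : (0 : ℝ) < 2 ^ (N * s) := Real.rpow_pos_of_pos (by norm_num) _
  have hXh : 0 < X ^ ((α + γ) * 2) := Real.rpow_pos_of_pos hX _
  have hG : 0 ≤ a ^ (2 : ℝ) / X ^ ((α + γ) * 2) := by positivity
  set r := Q ^ N⁻¹ with hr
  have hr0 : 0 < r := Real.rpow_pos_of_pos hQ0 _
  have hrN : r ^ N = Q := by rw [hr, ← Real.rpow_mul hQ0.le, inv_mul_cancel₀ hN.ne', Real.rpow_one]
  have hrNs : r ^ (N * s) = Q ^ s := by rw [Real.rpow_mul hr0.le, hrN]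
  -- If the optimal radius is admissible, the D-term must carry the other half of c * r^N. Otherwise
  -- X < 2r, and this alone bounds Φ by the Hardy term.
  rcases le_or_gt r (X / 2) with hrX | hrX
  · have h1 := h r hr0 hrX
    have h2 : B / a ^ p * X ^ (β * p) * t = c * Q / 2 := by
      rw [hQ, hΦ]; field_simp
    -- Here 2γ = N s + 2(β - α); the surplus power of r is bounded by that of X because β ≥ α.
    have h3 : r ^ (2 * γ) ≤ Q ^ s * X ^ (2 * (β - α)) := by
      have : r ^ (2 * γ) = Q ^ s * r ^ (2 * (β - α)) := by
        rw [← hrNs, ← Real.rpow_add hr0, hNs]; congr 1; ring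
      rw [this]
      have := Real.rpow_pos_of_pos hQ0 s
      gcongr
      · linarith
    rw [h2, Real.rpow_add hr0, hrN] at h1
    have h4 : c / 2 ≤ A / a ^ 2 * r ^ (2 * γ) * X ^ (2 * α) * D := by
      refine le_of_mul_le_mul_left ?_ hQ0
      linarith
    have h5 : c / 2 ≤ A / a ^ 2 * (Q ^ s * X ^ (2 * (β - α))) * X ^ (2 * α) * D :=
      h4.trans (by gcongr)
    have h6 : X ^ (2 * (β - α)) * X ^ (2 * α) = X ^ (2 * β) := by
      rw [← Real.rpow_add hX]; congr 1; ring
    have h7 : a ^ 2 / X ^ (2 * β) ≤ 2 * A / c * Q ^ s * D := by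
      have e : A / a ^ 2 * (Q ^ s * X ^ (2 * (β - α))) * X ^ (2 * α) * D =
          (2 * A / c * Q ^ s * D) * (c / 2) / (a ^ 2 / X ^ (2 * β)) := by
        rw [← h6]; field_simp
      rw [e, le_div_iff₀ (by positivity), mul_comm] at h5
      exact le_of_mul_le_mul_right h5 (by positivity)
    calc Φ = Φ ^ s * (a ^ 2 / X ^ (2 * β)) := hΦ2
      _ ≤ Φ ^ s * (2 * A / c * Q ^ s * D) := by gcongr
      _ = (Φ ^ s * Q ^ s) * (2 * A / c) * D := by ring
      _ = (2 * B / c) ^ s * (2 * A / c) * t ^ s * D := by rw [hQs]; ring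
      _ ≤ _ := by
        gcongr
        · linarith
        · linarith
  · have h1 : X ^ (N * s) ≤ 2 ^ (N * s) * Q ^ s := by
      rw [← hrNs, ← Real.mul_rpow (by norm_num) hr0.le]
      exact Real.rpow_le_rpow hX.le (by linarith) (by positivity)
    have h2 : a ^ 2 / X ^ (2 * β) = a ^ (2 : ℝ) / X ^ ((α + γ) * 2) * X ^ (N * s) := by
      have : X ^ ((α + γ) * 2) = X ^ (2 * β) * X ^ (N * s) := by
        rw [← Real.rpow_add hX, hNs]; congr 1; ring
      have := Real.rpow_pos_of_pos hX (N * s)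
      rw [‹X ^ ((α + γ) * 2) = _›, Real.rpow_two]
      field_simp
    calc Φ = Φ ^ s * (a ^ 2 / X ^ (2 * β)) := hΦ2
      _ ≤ Φ ^ s * (a ^ (2 : ℝ) / X ^ ((α + γ) * 2) * (2 ^ (N * s) * Q ^ s)) := by
        rw [h2]; gcongr
      _ = (Φ ^ s * Q ^ s) * 2 ^ (N * s) * (a ^ (2 : ℝ) / X ^ ((α + γ) * 2)) := by ring
      _ = (2 * B / c) ^ s * 2 ^ (N * s) * t ^ s * (a ^ (2 : ℝ) / X ^ ((α + γ) * 2)) := by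
        rw [hQs]; ring
      _ ≤ _ := by
        gcongr
        · have : 0 < 2 * A / c := by positivity
          linarith
        · linarith

section Pointwise

variable {n : ℕ} {γ α β p : ℝ} {u : EuclideanSpace ℝ (Fin n) → ℝ}

/-- Either |u(y)| ≥ |u(x)|/2, and the last term is at least 1, or |u(x) - u(y)| ≥ |u(x)|/2, and the
first one is. Since r ≤ ‖x‖/2, the norms of x and y are within a factor 2 of each other. -/
theorem one_le_of_mem_ball (hγ : 0 < γ) (hp : 0 < p) {x y : EuclideanSpace ℝ (Fin n)}
    (hx : x ≠ 0) (hux : u x ≠ 0) {r : ℝ} (hr : 0 < r) (hrx : r ≤ ‖x‖ / 2)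
    (hy : y ∈ Metric.ball x r) :
    1 ≤ 4 * 2 ^ |α| / |u x| ^ 2 * r ^ (n + 2 * γ) * ‖x‖ ^ (2 * α) *
        ((u x - u y) ^ 2 / (‖x - y‖ ^ ((n : ℝ) + 2 * γ) * ‖x‖ ^ α * ‖y‖ ^ α)) +
      2 ^ p * 2 ^ |β * p| / |u x| ^ p * ‖x‖ ^ (β * p) * (|u y| ^ p / ‖y‖ ^ (β * p)) := by
  have hx0 : 0 < ‖x‖ := norm_pos_iff.2 hx
  have ha : 0 < |u x| := abs_pos.2 hux
  rw [Metric.mem_ball, dist_comm, dist_eq_norm] at hy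
  have h1 : ‖y‖ ≤ 2 * ‖x‖ := by
    have := norm_sub_norm_le y x
    rw [norm_sub_rev] at this
    linarith
  have h2 : ‖x‖ ≤ 2 * ‖y‖ := by
    have := norm_sub_norm_le x y
    linarith
  have hy0 : 0 < ‖y‖ := by linarith
  have hxa := Real.rpow_pos_of_pos hx0 α
  have hya := Real.rpow_pos_of_pos hy0 α
  have hxb := Real.rpow_pos_of_pos hx0 (β * p)
  have hyb := Real.rpow_pos_of_pos hy0 (β * p)
  rcases le_or_gt (|u x| / 2) |u y| with h | h
  · refine le_add_of_nonneg_of_le (by positivity) ?_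
    have e1 : |u x| ^ p ≤ 2 ^ p * |u y| ^ p := by
      rw [← Real.mul_rpow (by norm_num) (abs_nonneg _)]
      exact Real.rpow_le_rpow ha.le (by linarith) hp.le
    have e2 : ‖y‖ ^ (β * p) ≤ 2 ^ |β * p| * ‖x‖ ^ (β * p) :=
      rpow_le_mul_rpow_of_comparable hy0 hx0 (by norm_num) h1 h2
    have e : 2 ^ p * 2 ^ |β * p| / |u x| ^ p * ‖x‖ ^ (β * p) * (|u y| ^ p / ‖y‖ ^ (β * p)) =
        (2 ^ p * |u y| ^ p) * (2 ^ |β * p| * ‖x‖ ^ (β * p)) / (|u x| ^ p * ‖y‖ ^ (β * p)) := by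
      field_simp
    rw [e, one_le_div (by positivity)]
    gcongr
  · refine le_add_of_le_of_nonneg ?_ (by positivity)
    have hd' : |u x| / 2 ≤ |u x - u y| := by
      have := abs_sub_abs_le_abs_sub (u x) (u y)
      linarith
    have hxy : x ≠ y := by
      rintro rfl
      linarith
    have hd : 0 < ‖x - y‖ := norm_pos_iff.2 (sub_ne_zero.2 hxy)
    have hdn := Real.rpow_pos_of_pos hd ((n : ℝ) + 2 * γ)
    have e1 : |u x| ^ 2 ≤ 4 * (u x - u y) ^ 2 := by
      rw [← sq_abs (u x - u y)]
      nlinarith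
    have e2 : ‖y‖ ^ α ≤ 2 ^ |α| * ‖x‖ ^ α :=
      rpow_le_mul_rpow_of_comparable hy0 hx0 (by norm_num) h1 h2
    have e3 : ‖x - y‖ ^ ((n : ℝ) + 2 * γ) ≤ r ^ ((n : ℝ) + 2 * γ) :=
      Real.rpow_le_rpow hd.le hy.le (by positivity)
    have e : 4 * 2 ^ |α| / |u x| ^ 2 * r ^ (n + 2 * γ) * ‖x‖ ^ (2 * α) *
        ((u x - u y) ^ 2 / (‖x - y‖ ^ ((n : ℝ) + 2 * γ) * ‖x‖ ^ α * ‖y‖ ^ α)) =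
        (4 * (u x - u y) ^ 2) * (r ^ (n + 2 * γ) * ‖x‖ ^ α * (2 ^ |α| * ‖x‖ ^ α)) /
          (|u x| ^ 2 * (‖x - y‖ ^ ((n : ℝ) + 2 * γ) * ‖x‖ ^ α * ‖y‖ ^ α)) := by
      rw [two_mul α, Real.rpow_add hx0]
      field_simp
    rw [e, one_le_div (by positivity)]
    gcongr

/-- `one_le_of_mem_ball` integrated over the ball; this is the hypothesis `h` of
`rpow_div_le_of_forall_radius`. -/
theorem volume_ball_le_of_radius_le (hn : 1 ≤ n) (hγ : 0 < γ) (hp : 0 < p) (hu : Measurable u)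
    {x : EuclideanSpace ℝ (Fin n)} (hx : x ≠ 0) (hux : u x ≠ 0)
    (hD : ∫⁻ y, ENNReal.ofReal
      ((u x - u y) ^ 2 / (‖x - y‖ ^ ((n : ℝ) + 2 * γ) * ‖x‖ ^ α * ‖y‖ ^ α)) ≠ ⊤)
    (hT : cknWeightedIntegral β p u ≠ ⊤) {r : ℝ} (hr : 0 < r) (hrx : r ≤ ‖x‖ / 2) :
    (volume (Metric.ball (0 : EuclideanSpace ℝ (Fin n)) 1)).toReal * r ^ (n : ℝ) ≤
      4 * 2 ^ |α| / |u x| ^ 2 * r ^ (n + 2 * γ) * ‖x‖ ^ (2 * α) *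
        (∫⁻ y, ENNReal.ofReal
          ((u x - u y) ^ 2 / (‖x - y‖ ^ ((n : ℝ) + 2 * γ) * ‖x‖ ^ α * ‖y‖ ^ α))).toReal +
      2 ^ p * 2 ^ |β * p| / |u x| ^ p * ‖x‖ ^ (β * p) * (cknWeightedIntegral β p u).toReal := by
  have : Nonempty (Fin n) := ⟨⟨0, hn⟩⟩
  set A := 4 * 2 ^ |α| / |u x| ^ 2 * r ^ (n + 2 * γ) * ‖x‖ ^ (2 * α) with hA
  set B := 2 ^ p * 2 ^ |β * p| / |u x| ^ p * ‖x‖ ^ (β * p) with hB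
  have hA0 : 0 ≤ A := by positivity
  have hB0 : 0 ≤ B := by positivity
  set D := ∫⁻ y, ENNReal.ofReal
      ((u x - u y) ^ 2 / (‖x - y‖ ^ ((n : ℝ) + 2 * γ) * ‖x‖ ^ α * ‖y‖ ^ α)) with hDdef
  have key : volume (Metric.ball x r) ≤
      ENNReal.ofReal A * D + ENNReal.ofReal B * cknWeightedIntegral β p u := by
    calc volume (Metric.ball x r) = ∫⁻ y in Metric.ball x r, 1 := by simp
      _ ≤ ∫⁻ y in Metric.ball x r, (ENNReal.ofReal A * ENNReal.ofReal
            ((u x - u y) ^ 2 / (‖x - y‖ ^ ((n : ℝ) + 2 * γ) * ‖x‖ ^ α * ‖y‖ ^ α)) +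
          ENNReal.ofReal B * ENNReal.ofReal (|u y| ^ p / ‖y‖ ^ (β * p))) := by
          refine setLIntegral_mono' Metric.isOpen_ball.measurableSet fun y hy => ?_
          rw [← ENNReal.ofReal_mul hA0, ← ENNReal.ofReal_mul hB0,
            ← ENNReal.ofReal_add (by positivity) (by positivity), ← ENNReal.ofReal_one]
          exact ENNReal.ofReal_le_ofReal (one_le_of_mem_ball hγ hp hx hux hr hrx hy)
      _ ≤ ∫⁻ y, (ENNReal.ofReal A * ENNReal.ofReal
            ((u x - u y) ^ 2 / (‖x - y‖ ^ ((n : ℝ) + 2 * γ) * ‖x‖ ^ α * ‖y‖ ^ α)) +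
          ENNReal.ofReal B * ENNReal.ofReal (|u y| ^ p / ‖y‖ ^ (β * p))) :=
          setLIntegral_le_lintegral _ _
      _ = _ := by
          rw [lintegral_add_left (by fun_prop), lintegral_const_mul' _ _ ENNReal.ofReal_ne_top,
            lintegral_const_mul' _ _ ENNReal.ofReal_ne_top]
          rfl
  have h1 := ENNReal.toReal_mono (ENNReal.add_ne_top.2
    ⟨ENNReal.mul_ne_top ENNReal.ofReal_ne_top hD, ENNReal.mul_ne_top ENNReal.ofReal_ne_top hT⟩) key
  rw [ENNReal.toReal_add (ENNReal.mul_ne_top ENNReal.ofReal_ne_top hD)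
    (ENNReal.mul_ne_top ENNReal.ofReal_ne_top hT), ENNReal.toReal_mul, ENNReal.toReal_mul,
    ENNReal.toReal_ofReal hA0, ENNReal.toReal_ofReal hB0, Measure.addHaar_ball _ _ hr.le,
    ENNReal.toReal_mul, ENNReal.toReal_ofReal (by positivity)] at h1
  simp only [finrank_euclideanSpace, Fintype.card_fin] at h1
  rw [Real.rpow_natCast, mul_comm]
  exact h1

theorem pointwise_bound (hn : 1 ≤ n) (hγ : 0 < γ) (hαβ : α ≤ β) (hp : 0 < p) {s : ℝ}
    (hs : s = 1 - 2 / p) (hs0 : 0 ≤ s) (hns : n * s = 2 * (γ - (β - α))) :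
    ∃ C : ℝ, 0 ≤ C ∧ ∀ u : EuclideanSpace ℝ (Fin n) → ℝ, Measurable u →
      cknWeightedIntegral β p u ≠ ⊤ → cknWeightedIntegral β p u ≠ 0 →
      ∀ x : EuclideanSpace ℝ (Fin n), x ≠ 0 →
        ENNReal.ofReal (|u x| ^ p / ‖x‖ ^ (β * p)) ≤
          ENNReal.ofReal C * cknWeightedIntegral β p u ^ s *
            ((∫⁻ y, ENNReal.ofReal
              ((u x - u y) ^ 2 / (‖x - y‖ ^ ((n : ℝ) + 2 * γ) * ‖x‖ ^ α * ‖y‖ ^ α))) +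
            ENNReal.ofReal (|u x| ^ (2 : ℝ) / ‖x‖ ^ ((α + γ) * 2))) := by
  have : Nonempty (Fin n) := ⟨⟨0, hn⟩⟩
  set c := (volume (Metric.ball (0 : EuclideanSpace ℝ (Fin n)) 1)).toReal with hc
  have hc0 : 0 < c := ENNReal.toReal_pos (Metric.measure_ball_pos _ _ one_pos).ne'
    measure_ball_lt_top.ne
  set A : ℝ := 4 * 2 ^ |α| with hA
  set B : ℝ := 2 ^ p * 2 ^ |β * p| with hB
  have hA0 : 0 < A := by positivity
  have hB0 : 0 < B := by positivity
  have hC0 : 0 < (2 * B / c) ^ s * (2 * A / c + 2 ^ (n * s)) := by positivity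
  refine ⟨(2 * B / c) ^ s * (2 * A / c + 2 ^ (n * s)), hC0.le, fun u hu hT hT0 x hx => ?_⟩
  set T := cknWeightedIntegral β p u with hTdef
  set D := ∫⁻ y, ENNReal.ofReal
      ((u x - u y) ^ 2 / (‖x - y‖ ^ ((n : ℝ) + 2 * γ) * ‖x‖ ^ α * ‖y‖ ^ α)) with hDdef
  by_cases hux : u x = 0
  · simp [hux, Real.zero_rpow hp.ne']
  have ht : 0 < T.toReal := ENNReal.toReal_pos hT0 hT
  -- The right side is then infinite, since neither the constant nor T^s vanishes.
  by_cases hD : D = ⊤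
  · have hTs : T ^ s ≠ 0 := by
      simp [ENNReal.rpow_eq_zero_iff, hT0, hT]
    rw [hD, top_add, ENNReal.mul_top (mul_ne_zero (by simpa using hC0) hTs)]
    exact le_top
  have hn0 : (0 : ℝ) < n := by exact_mod_cast hn
  have h := rpow_div_le_of_forall_radius hn0 hp hs hs0 hns hαβ hc0 hA0 hB0 ht (abs_pos.2 hux)
    (norm_pos_iff.2 hx) (ENNReal.toReal_nonneg (a := D))
    (fun r hr hrx => volume_ball_le_of_radius_le hn hγ hp hu hx hux hD hT hr hrx)
  refine (ENNReal.ofReal_le_ofReal h).trans (le_of_eq ?_)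
  rw [ENNReal.ofReal_mul (by positivity), ENNReal.ofReal_mul hC0.le,
    ENNReal.ofReal_add ENNReal.toReal_nonneg (by positivity), ENNReal.ofReal_toReal hD,
    ← ENNReal.ofReal_rpow_of_pos ht, ENNReal.ofReal_toReal hT]

end Pointwise

/-! ### Finiteness of the energy -/

theorem lintegral_lintegral_mul_sub {n : ℕ} {f g : EuclideanSpace ℝ (Fin n) → ℝ≥0∞}
    (hf : Measurable f) (hg : Measurable g) :
    ∫⁻ x, ∫⁻ y, f x * g (x - y) = (∫⁻ x, f x) * ∫⁻ z, g z := by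
  have h : ∀ x, ∫⁻ y, f x * g (x - y) = f x * ∫⁻ z, g z := fun x => by
    rw [lintegral_const_mul _ (by fun_prop), lintegral_sub_left_eq_self g x]
  simp_rw [h]
  rw [lintegral_mul_const _ hf]

theorem lintegral_lintegral_mul_sub_swap {n : ℕ} {f g : EuclideanSpace ℝ (Fin n) → ℝ≥0∞}
    (hf : Measurable f) (hg : Measurable g) :
    ∫⁻ x, ∫⁻ y, f y * g (y - x) = (∫⁻ x, f x) * ∫⁻ z, g z := by
  rw [← lintegral_lintegral_mul_sub hf hg,
    lintegral_lintegral_swap (f := fun x y => f y * g (y - x)) (by fun_prop)]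

section Kernel

variable {n : ℕ} {γ α : ℝ} {u : EuclideanSpace ℝ (Fin n) → ℝ}

theorem kernel_comm (x y : EuclideanSpace ℝ (Fin n)) :
    (u x - u y) ^ 2 / (‖x - y‖ ^ ((n : ℝ) + 2 * γ) * ‖x‖ ^ α * ‖y‖ ^ α) =
      (u y - u x) ^ 2 / (‖y - x‖ ^ ((n : ℝ) + 2 * γ) * ‖y‖ ^ α * ‖x‖ ^ α) := by
  rw [norm_sub_rev, mul_right_comm, ← neg_sub (u y), neg_sq]

/-- The Lipschitz bound removes two powers of ‖x - y‖, and ab ≤ a² + b² decouples the weights. Each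
summand then has the form f(x)g(x - y), up to exchanging x and y, whose local integrability needs
only 2α < n and γ < 1. -/
theorem kernel_le_of_lipschitz {L : ℝ} (hL : ∀ x y, |u x - u y| ≤ L * ‖x - y‖)
    (x y : EuclideanSpace ℝ (Fin n)) :
    (u x - u y) ^ 2 / (‖x - y‖ ^ ((n : ℝ) + 2 * γ) * ‖x‖ ^ α * ‖y‖ ^ α) ≤
      L ^ 2 * (‖x‖ ^ (2 * α))⁻¹ * (‖x - y‖ ^ ((n : ℝ) + 2 * γ - 2))⁻¹ +
      L ^ 2 * (‖y‖ ^ (2 * α))⁻¹ * (‖y - x‖ ^ ((n : ℝ) + 2 * γ - 2))⁻¹ := by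
  rcases eq_or_ne x y with rfl | hxy
  · simp only [sub_self, ne_eq, OfNat.ofNat_ne_zero, not_false_eq_true, zero_pow, zero_div]
    positivity
  have hd : 0 < ‖x - y‖ := norm_pos_iff.2 (sub_ne_zero.2 hxy)
  have hw : ∀ z : EuclideanSpace ℝ (Fin n), (‖z‖ ^ (2 * α))⁻¹ = ((‖z‖ ^ α)⁻¹) ^ 2 := fun z => by
    rw [mul_comm, Real.rpow_mul (norm_nonneg z), Real.rpow_two, inv_pow]
  have hsq : (u x - u y) ^ 2 ≤ L ^ 2 * ‖x - y‖ ^ 2 := by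
    rw [← sq_abs, ← mul_pow]
    exact pow_le_pow_left₀ (abs_nonneg _) (hL x y) 2
  have hk : ‖x - y‖ ^ 2 * (‖x - y‖ ^ ((n : ℝ) + 2 * γ))⁻¹ =
      (‖x - y‖ ^ ((n : ℝ) + 2 * γ - 2))⁻¹ := by
    rw [Real.rpow_sub hd, Real.rpow_two, inv_div, div_eq_mul_inv]
  have hxa : 0 ≤ (‖x‖ ^ α)⁻¹ := by positivity
  have hya : 0 ≤ (‖y‖ ^ α)⁻¹ := by positivity
  rw [norm_sub_rev y x, hw, hw, ← hk, div_eq_mul_inv, mul_inv, mul_inv]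
  calc (u x - u y) ^ 2 * ((‖x - y‖ ^ ((n : ℝ) + 2 * γ))⁻¹ * (‖x‖ ^ α)⁻¹ * (‖y‖ ^ α)⁻¹)
      ≤ (L ^ 2 * ‖x - y‖ ^ 2) *
        ((‖x - y‖ ^ ((n : ℝ) + 2 * γ))⁻¹ * ((‖x‖ ^ α)⁻¹ * (‖y‖ ^ α)⁻¹)) := by
        rw [mul_assoc (‖x - y‖ ^ ((n : ℝ) + 2 * γ))⁻¹]
        gcongr
    _ ≤ (L ^ 2 * ‖x - y‖ ^ 2) * ((‖x - y‖ ^ ((n : ℝ) + 2 * γ))⁻¹ *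
        ((‖x‖ ^ α)⁻¹ ^ 2 + (‖y‖ ^ α)⁻¹ ^ 2)) := by
        gcongr
        nlinarith [sq_nonneg ((‖x‖ ^ α)⁻¹ - (‖y‖ ^ α)⁻¹), sq_nonneg ((‖x‖ ^ α)⁻¹),
          sq_nonneg ((‖y‖ ^ α)⁻¹)]
    _ = _ := by ring

/-- Here ‖x - y‖ ≥ ‖y‖/2, so the bound factors into functions of x and y. The factor in y is
integrable at infinity when α > -2γ. -/
theorem kernel_le_of_far {M R : ℝ} (hγ : 0 < γ) (hR : 0 < R) (hM : ∀ x, |u x| ≤ M)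
    {x y : EuclideanSpace ℝ (Fin n)} (hx : ‖x‖ < R) (hy : 2 * R ≤ ‖y‖) (huy : u y = 0) :
    (u x - u y) ^ 2 / (‖x - y‖ ^ ((n : ℝ) + 2 * γ) * ‖x‖ ^ α * ‖y‖ ^ α) ≤
      M ^ 2 * (‖x‖ ^ α)⁻¹ * (2 ^ ((n : ℝ) + 2 * γ) * (‖y‖ ^ ((n : ℝ) + 2 * γ + α))⁻¹) := by
  have hy0 : 0 < ‖y‖ := by linarith
  have hd : ‖y‖ / 2 ≤ ‖x - y‖ := by
    have := norm_sub_norm_le y x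
    rw [norm_sub_rev] at this
    linarith
  have hd2 : (‖x - y‖ ^ ((n : ℝ) + 2 * γ))⁻¹ ≤
      2 ^ ((n : ℝ) + 2 * γ) * (‖y‖ ^ ((n : ℝ) + 2 * γ))⁻¹ := by
    have h1 : (‖y‖ / 2) ^ ((n : ℝ) + 2 * γ) ≤ ‖x - y‖ ^ ((n : ℝ) + 2 * γ) :=
      Real.rpow_le_rpow (by positivity) hd (by positivity)
    have h2 : 0 < (‖y‖ / 2) ^ ((n : ℝ) + 2 * γ) := Real.rpow_pos_of_pos (by positivity) _
    refine (inv_anti₀ h2 h1).trans (le_of_eq ?_)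
    rw [Real.div_rpow hy0.le (by norm_num), inv_div, div_eq_mul_inv]
  have hsq : (u x - u y) ^ 2 ≤ M ^ 2 := by
    rw [huy, sub_zero, ← sq_abs]
    exact pow_le_pow_left₀ (abs_nonneg _) (hM x) 2
  rw [div_eq_mul_inv, mul_inv, mul_inv, Real.rpow_add hy0 _ α, mul_inv]
  calc (u x - u y) ^ 2 * ((‖x - y‖ ^ ((n : ℝ) + 2 * γ))⁻¹ * (‖x‖ ^ α)⁻¹ * (‖y‖ ^ α)⁻¹)
      ≤ M ^ 2 * ((2 ^ ((n : ℝ) + 2 * γ) * (‖y‖ ^ ((n : ℝ) + 2 * γ))⁻¹) *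
          (‖x‖ ^ α)⁻¹ * (‖y‖ ^ α)⁻¹) := by gcongr
    _ = _ := by ring

/-- The weighted fractional energy of a compactly supported Lipschitz function is finite. -/
theorem cknEnergy_lt_top (hn : 1 ≤ n) (hγ₀ : 0 < γ) (hγ₁ : γ < 1) (hα₀ : -2 * γ < α)
    (hα₁ : 2 * α < n) {L : ℝ} (hu : Continuous u) (hc : HasCompactSupport u)
    (hL : ∀ x y, |u x - u y| ≤ L * ‖x - y‖) : cknEnergy γ α u < ⊤ := by
  obtain ⟨M, hM⟩ := hu.bounded_above_of_compact_support hc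
  obtain ⟨R, hR0, hR⟩ := hc.isCompact.isBounded.subset_ball_lt 0 0
  have hzero : ∀ x, R ≤ ‖x‖ → u x = 0 := by
    intro x hx
    by_contra h
    have := hR (subset_tsupport _ h)
    rw [mem_ball_zero_iff] at this
    linarith
  have hαn : α < n := by
    have : (1 : ℝ) ≤ n := by exact_mod_cast hn
    linarith
  set d := (n : ℝ) + 2 * γ with hd
  set f : EuclideanSpace ℝ (Fin n) → ℝ≥0∞ := (Metric.ball 0 (2 * R)).indicator
    (fun x => ENNReal.ofReal (L ^ 2) * ENNReal.ofReal ((‖x‖ ^ (2 * α))⁻¹)) with hf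
  set g : EuclideanSpace ℝ (Fin n) → ℝ≥0∞ := (Metric.ball 0 (4 * R)).indicator
    (fun z => ENNReal.ofReal ((‖z‖ ^ (d - 2))⁻¹)) with hg
  set h : EuclideanSpace ℝ (Fin n) → ℝ≥0∞ := (Metric.ball 0 R).indicator
    (fun x => ENNReal.ofReal (M ^ 2) * ENNReal.ofReal ((‖x‖ ^ α)⁻¹)) with hh
  set k : EuclideanSpace ℝ (Fin n) → ℝ≥0∞ := (Metric.ball 0 (2 * R))ᶜ.indicator
    (fun y => ENNReal.ofReal (2 ^ d) * ENNReal.ofReal ((‖y‖ ^ (d + α))⁻¹)) with hk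
  have hball : ∀ r, MeasurableSet (Metric.ball (0 : EuclideanSpace ℝ (Fin n)) r) :=
    fun r => Metric.isOpen_ball.measurableSet
  have hfm : Measurable f := Measurable.indicator (by fun_prop) (hball _)
  have hgm : Measurable g := Measurable.indicator (by fun_prop) (hball _)
  have hhm : Measurable h := Measurable.indicator (by fun_prop) (hball _)
  have hkm : Measurable k := Measurable.indicator (by fun_prop) (hball _).compl
  have hfi : ∫⁻ x, f x < ⊤ := by
    rw [lintegral_indicator (hball _), lintegral_const_mul' _ _ ENNReal.ofReal_ne_top]
    exact ENNReal.mul_lt_top ENNReal.ofReal_lt_top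
      (lintegral_ball_inv_norm_rpow_lt_top hn hα₁ _)
  have hgi : ∫⁻ x, g x < ⊤ := by
    rw [lintegral_indicator (hball _)]
    exact lintegral_ball_inv_norm_rpow_lt_top hn (by rw [hd]; linarith) _
  have hhi : ∫⁻ x, h x < ⊤ := by
    rw [lintegral_indicator (hball _), lintegral_const_mul' _ _ ENNReal.ofReal_ne_top]
    exact ENNReal.mul_lt_top ENNReal.ofReal_lt_top
      (lintegral_ball_inv_norm_rpow_lt_top hn hαn _)
  have hki : ∫⁻ x, k x < ⊤ := by
    rw [lintegral_indicator (hball _).compl, lintegral_const_mul' _ _ ENNReal.ofReal_ne_top]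
    exact ENNReal.mul_lt_top ENNReal.ofReal_lt_top
      (lintegral_compl_ball_inv_norm_rpow_lt_top hn (by rw [hd]; linarith) (by positivity))
  have hfar : ∀ x y : EuclideanSpace ℝ (Fin n), 2 * R ≤ ‖y‖ →
      ENNReal.ofReal ((u x - u y) ^ 2 / (‖x - y‖ ^ d * ‖x‖ ^ α * ‖y‖ ^ α)) ≤ h x * k y := by
    intro x y hy
    have huy := hzero y (by linarith)
    rcases le_or_gt R ‖x‖ with hx | hx
    · simp [hzero x hx, huy]
    · rw [hh, hk, Set.indicator_of_mem (by simpa using hx),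
        Set.indicator_of_mem (by simpa using hy), ← ENNReal.ofReal_mul (by positivity),
        ← ENNReal.ofReal_mul (by positivity), ← ENNReal.ofReal_mul (by positivity)]
      exact ENNReal.ofReal_le_ofReal (kernel_le_of_far hγ₀ hR0 hM hx hy huy)
  -- If both norms are below 2R, then x - y lies in the ball of radius 4R and the Lipschitz bound
  -- applies. Otherwise one point is far from the support and `hfar` applies, possibly after
  -- exchanging x and y.
  have hbound : ∀ x y : EuclideanSpace ℝ (Fin n),
      ENNReal.ofReal ((u x - u y) ^ 2 / (‖x - y‖ ^ d * ‖x‖ ^ α * ‖y‖ ^ α)) ≤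
        (f x * g (x - y) + f y * g (y - x)) + (h x * k y + k x * h y) := by
    intro x y
    rcases le_or_gt (2 * R) ‖y‖ with hy | hy
    · exact (hfar x y hy).trans (le_add_self.trans' le_self_add)
    rcases le_or_gt (2 * R) ‖x‖ with hx | hx
    · rw [kernel_comm]
      refine (hfar y x hx).trans ?_
      rw [mul_comm (k x)]
      exact le_add_self.trans' le_add_self
    refine le_trans ?_ le_self_add
    have hxy : ‖x - y‖ < 4 * R := (norm_sub_le x y).trans_lt (by linarith)
    have hyx : ‖y - x‖ < 4 * R := by rwa [norm_sub_rev]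
    rw [hf, hg, Set.indicator_of_mem (mem_ball_zero_iff.2 hx),
      Set.indicator_of_mem (mem_ball_zero_iff.2 hxy), Set.indicator_of_mem (mem_ball_zero_iff.2 hy),
      Set.indicator_of_mem (mem_ball_zero_iff.2 hyx),
      ← ENNReal.ofReal_mul (by positivity), ← ENNReal.ofReal_mul (by positivity),
      ← ENNReal.ofReal_mul (by positivity), ← ENNReal.ofReal_mul (by positivity),
      ← ENNReal.ofReal_add (by positivity) (by positivity)]
    exact ENNReal.ofReal_le_ofReal (kernel_le_of_lipschitz hL x y)
  calc cknEnergy γ α u ≤ ∫⁻ x, ∫⁻ y,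
        ((f x * g (x - y) + f y * g (y - x)) + (h x * k y + k x * h y)) :=
        lintegral_mono fun x => lintegral_mono fun y => hbound x y
    _ = ((∫⁻ x, f x) * (∫⁻ z, g z) + (∫⁻ x, f x) * ∫⁻ z, g z) +
        ((∫⁻ x, h x) * (∫⁻ y, k y) + (∫⁻ x, k x) * ∫⁻ y, h y) := by
        have e : ∀ x, ∫⁻ y, ((f x * g (x - y) + f y * g (y - x)) + (h x * k y + k x * h y)) =
            ((∫⁻ y, f x * g (x - y)) + ∫⁻ y, f y * g (y - x)) +
              (h x * (∫⁻ y, k y) + k x * ∫⁻ y, h y) := fun x => by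
          rw [lintegral_add_left (by fun_prop), lintegral_add_left (by fun_prop),
            lintegral_add_left (by fun_prop), lintegral_const_mul _ hkm,
            lintegral_const_mul _ hhm]
        simp_rw [e]
        have m1 : Measurable fun x => ∫⁻ y, f x * g (x - y) :=
          Measurable.lintegral_prod_right' (f := fun q => f q.1 * g (q.1 - q.2)) (by fun_prop)
        have m2 : Measurable fun x => ∫⁻ y, f y * g (y - x) :=
          Measurable.lintegral_prod_right' (f := fun q => f q.2 * g (q.2 - q.1)) (by fun_prop)
        rw [lintegral_add_left (by fun_prop), lintegral_add_left m1,
          lintegral_add_left (hhm.mul_const _), lintegral_mul_const _ hhm,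
          lintegral_mul_const _ hkm, lintegral_lintegral_mul_sub hfm hgm,
          lintegral_lintegral_mul_sub_swap hfm hgm]
    _ < ⊤ := by
        simp only [ENNReal.add_lt_top]
        exact ⟨⟨ENNReal.mul_lt_top hfi hgi, ENNReal.mul_lt_top hfi hgi⟩,
          ENNReal.mul_lt_top hhi hki, ENNReal.mul_lt_top hki hhi⟩

end Kernel

/-! ### Conclusion -/

theorem exists_weightedIntegral_rpow_le {n : ℕ} {γ α β p : ℝ} (hn : 1 ≤ n) (hγ : 0 < γ)
    (hαβ : α ≤ β) (hα₁ : α < ((n : ℝ) - 2 * γ) / 2) (hp : 0 < p) (hp2 : 0 ≤ 1 - 2 / p)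
    (hnp : n * (1 - 2 / p) = 2 * (γ - (β - α))) :
    ∃ K : ℝ≥0∞, K ≠ ⊤ ∧ ∀ u : EuclideanSpace ℝ (Fin n) → ℝ, Measurable u →
      cknWeightedIntegral β p u ≠ ⊤ → cknWeightedIntegral (α + γ) 2 u ≠ ⊤ →
      cknWeightedIntegral β p u ^ (2 / p) ≤ K * cknEnergy γ α u := by
  have : Nonempty (Fin n) := ⟨⟨0, hn⟩⟩
  obtain ⟨C₁, hC₁, hardy⟩ := hardy_weighted hn hγ hα₁
  obtain ⟨C₂, -, hpt⟩ := pointwise_bound hn hγ hαβ hp rfl hp2 hnp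
  refine ⟨ENNReal.ofReal C₂ * (1 + C₁), ENNReal.mul_ne_top ENNReal.ofReal_ne_top
    (ENNReal.add_ne_top.2 ⟨ENNReal.one_ne_top, hC₁⟩), fun u hu hT hH => ?_⟩
  set T := cknWeightedIntegral β p u with hTdef
  rcases eq_or_ne T 0 with hT0 | hT0
  · rw [hT0, ENNReal.zero_rpow_of_pos (by positivity)]
    exact bot_le
  set s := 1 - 2 / p with hs
  have hTs0 : T ^ s ≠ 0 := by simp [ENNReal.rpow_eq_zero_iff, hT0, hT]
  have hTst : T ^ s ≠ ⊤ := ENNReal.rpow_ne_top_of_nonneg hp2 hT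
  have hTT : T ^ s * T ^ (2 / p) = T := by
    rw [← ENNReal.rpow_add _ _ hT0 hT, hs, sub_add_cancel, ENNReal.rpow_one]
  have key : T ^ s * T ^ (2 / p) ≤
      T ^ s * (ENNReal.ofReal C₂ * (1 + C₁) * cknEnergy γ α u) := by
    rw [hTT]
    calc T ≤ ∫⁻ x, ENNReal.ofReal C₂ * T ^ s *
            ((∫⁻ y, ENNReal.ofReal
              ((u x - u y) ^ 2 / (‖x - y‖ ^ ((n : ℝ) + 2 * γ) * ‖x‖ ^ α * ‖y‖ ^ α))) +
            ENNReal.ofReal (|u x| ^ (2 : ℝ) / ‖x‖ ^ ((α + γ) * 2))) := by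
          refine lintegral_mono_ae ?_
          filter_upwards [Measure.ae_ne volume (0 : EuclideanSpace ℝ (Fin n))] with x hx
          exact hpt u hu hT hT0 x hx
      _ = ENNReal.ofReal C₂ * T ^ s * (cknEnergy γ α u + cknWeightedIntegral (α + γ) 2 u) := by
          rw [lintegral_const_mul' _ _ (ENNReal.mul_ne_top ENNReal.ofReal_ne_top hTst),
            lintegral_add_right _ (by fun_prop)]
          rfl
      _ ≤ ENNReal.ofReal C₂ * T ^ s * (cknEnergy γ α u + C₁ * cknEnergy γ α u) := by
          gcongr
          exact hardy u hu hH
      _ = _ := by ring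
  -- T^s can be cancelled because T is neither 0 nor infinite.
  exact (ENNReal.mul_le_mul_iff_right hTs0 hTst).1 key

/-- Finiteness of the weighted integral needs no separate clause: it follows from the inequality, as
Λ and 2/p are positive and the energy is finite. -/
theorem proposition1p1 (n : ℕ) (hn : 2 ≤ n) (γ α β : ℝ)
    (hγ₀ : 0 < γ) (hγ₁ : γ < 1)
    (hαβ : α ≤ β) (hβα : β ≤ α + γ)
    (hα₀ : -2 * γ < α) (hα₁ : α < ((n : ℝ) - 2 * γ) / 2) :
    ∃ Λ : ℝ, 0 < Λ ∧
      ∀ u : EuclideanSpace ℝ (Fin n) → ℝ, ContDiff ℝ ∞ u → HasCompactSupport u →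
        cknEnergy γ α u < ⊤ ∧
        ENNReal.ofReal Λ *
            cknWeightedIntegral β (cknExponent n γ α β) u ^ (2 / cknExponent n γ α β) ≤
          cknEnergy γ α u := by
  have hn1 : 1 ≤ n := by omega
  have hn2 : (2 : ℝ) ≤ n := by exact_mod_cast hn
  have hden : 0 < (n : ℝ) - 2 * γ + 2 * (β - α) := by linarith
  set p := cknExponent n γ α β with hp
  have hp0 : 0 < p := by
    rw [hp, cknExponent]
    positivity
  have h2p : n * (1 - 2 / p) = 2 * (γ - (β - α)) := by
    rw [hp, cknExponent]
    field_simp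
    ring
  have hs0 : 0 ≤ 1 - 2 / p := by
    refine nonneg_of_mul_nonneg_right (b := 1 - 2 / p) (a := (n : ℝ)) ?_ (by linarith)
    rw [h2p]
    linarith
  -- After clearing the denominator β cancels, leaving exactly α < (n - 2γ)/2.
  have hβp : β * p < n := by
    rw [hp, cknExponent, mul_div_assoc', div_lt_iff₀ hden]
    nlinarith
  obtain ⟨K, hK, hmain⟩ := exists_weightedIntegral_rpow_le hn1 hγ₀ hαβ hα₁ hp0 hs0 h2p
  have hK1 : 0 < K.toReal + 1 := by positivity
  -- Adding 1 keeps Λ positive and Λ K ≤ 1 even when K = 0.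
  refine ⟨(K.toReal + 1)⁻¹, inv_pos.2 hK1, fun u hu hc => ⟨?_, ?_⟩⟩
  · obtain ⟨L, hL⟩ := hu.lipschitzWith_of_hasCompactSupport hc (by simp)
    refine cknEnergy_lt_top hn1 hγ₀ hγ₁ hα₀ (by linarith) hu.continuous hc (L := L) fun x y => ?_
    simpa [Real.dist_eq, dist_eq_norm] using hL.dist_le_mul x y
  · have hT := cknWeightedIntegral_lt_top hn1 hp0 hβp hu.continuous hc
    have hH := cknWeightedIntegral_lt_top hn1 (β := α + γ) two_pos (by linarith) hu.continuous hc
    have hΛ : ENNReal.ofReal (K.toReal + 1)⁻¹ * K ≤ 1 := by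
      rw [← ENNReal.ofReal_toReal hK, ← ENNReal.ofReal_mul (by positivity),
        ENNReal.ofReal_le_one, ENNReal.toReal_ofReal ENNReal.toReal_nonneg, inv_mul_le_one₀ hK1]
      linarith
    calc _ ≤ ENNReal.ofReal (K.toReal + 1)⁻¹ * (K * cknEnergy γ α u) := by
          gcongr
          exact hmain u hu.continuous.measurable hT.ne hH.ne
      _ = ENNReal.ofReal (K.toReal + 1)⁻¹ * K * cknEnergy γ α u := by rw [mul_assoc]
      _ ≤ 1 * cknEnergy γ α u := by gcongr
      _ = cknEnergy γ α u := one_mul _
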